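/- Let $N,M\ge 0$ be integers and $L=N+M$. Let $K$ be a field (for example $K=\mathbb{C}$, or a field of rational functions over $\mathbb{C}$ in formal variables), let $x_1,\dots,x_N,\ y_1,\dots,y_M,\ \alpha_1,\dots,\alpha_L,\ \gamma_1,\dots,\gamma_L,\ t\in K$, and let $\sqrt{-t}\in K$ be a fixed square root of $-t$ (either one, if there are two). For $n\ge 0$, parameters $\{a\}=(a_1,\dots,a_L)$, $\{g\}=(g_1,\dots,g_L)$, nonzero $z_1,\dots,z_n$ and a partition $\lambda=(\lambda_1\ge\dots\ge\lambda_n\ge 0)$, put $\mu_j=\lambda_j+n-j$ and define the generalized Whittaker functions $$o^\pm_\lambda(\{z\}_n|\{a\}|\{g\}|t)=\frac{\det\bigl(h^\pm_{\mu_j}(z_k)-h^\pm_{\mu_j}(z_k^{-1})\bigr)_{1\le j,k\le n}}{\det\bigl(z_k^{\,n-j+1}-z_k^{-n+j-1}\bigr)_{1\le j,k\le n}},$$ where $$h^\pm_\mu(z)=(z\pm\sqrt{-t})\prod_{j=1}^{\mu}\bigl(a_j+(1-a_jg_j)z\bigr)\prod_{j=\mu+2}^{L}(1-g_jz)\prod_{j=1}^{L}(1-g_jz^{-1}).$$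 Assume that all $x_j$ and $y_k$ are nonzero and that the two denominators $\det(x_k^{\,N-j+1}-x_k^{-N+j-1})_{1\le j,k\le N}$ and $\det(y_k^{\,M-j+1}-y_k^{-M+j-1})_{1\le j,k\le M}$ are nonzero. **Theorem (dual Cauchy formula for generalized Whittaker functions).** Writing $\{-\alpha\}=(-\alpha_1,\dots,-\alpha_L)$ and $\{-\gamma\}=(-\gamma_1,\dots,-\gamma_L)$, $$\sum_{\lambda\subseteq M^N}o^+_\lambda(\{x\}_N|\{\alpha\}|\{\gamma\}|t)\;o^-_{\hat\lambda}(\{y\}_M|\{-\alpha\}|\{-\gamma\}|t)$$ $$=\prod_{k=1}^M y_k^{-N}\prod_{j=1}^{N+M}(1+\sqrt{-t}\,\gamma_j)\prod_{j=1}^N\prod_{k=1}^M(1+x_jy_k)(1+x_j^{-1}y_k)\prod_{1\le j<k\le N+M}\bigl(1+\alpha_j(\gamma_k-\gamma_j)\bigr)\prod_{1\le j<k\le N+M}(1-\gamma_j\gamma_k),$$ where the sum runs over all partitions $\lambda=(\lambda_1,\dots,\lambda_N)$ with $M\ge\lambda_1\ge\dots\ge\lambda_N\ge 0$, and $\hat\lambda=(\hat\lambda_1,\dots,\hat\lambda_M)$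 is given by $\hat\lambda_i=|\{j\in\{1,\dots,N\}:\lambda_j\le M-i\}|$. -/

import Mathlib

namespace DualCauchy

/-- The one-variable function
`h_μ(z) = (z + c) ∏_{j=1}^{μ} (α_j + (1 - α_j γ_j) z) ∏_{j=μ+2}^{L} (1 - γ_j z) ∏_{j=1}^{L} (1 - γ_j z⁻¹)`.
For a square root `r` of `-t`, `h⁺` is the case `c = r` and `h⁻` the case `c = -r`.
The entry `α i` with `i : Fin L` is `α_{i+1}`; thus `j ≤ μ` reads `i < μ`, and
`μ + 2 ≤ j` reads `μ < i`. -/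
def h {K : Type*} [Field K] {L : ℕ} (c : K) (α γ : Fin L → K) (μ : ℕ) (z : K) : K :=
  (z + c) *
    (∏ i ∈ Finset.univ.filter (fun i : Fin L => (i : ℕ) < μ), (α i + (1 - α i * γ i) * z)) *
    (∏ i ∈ Finset.univ.filter (fun i : Fin L => μ < (i : ℕ)), (1 - γ i * z)) *
    ∏ i : Fin L, (1 - γ i * z⁻¹)

/-- The determinant `H_μ = det (h_{μ_j}(z_k) - h_{μ_j}(z_k⁻¹))`. -/
def H {K : Type*} [Field K] {n L : ℕ} (c : K) (α γ : Fin L → K) (μ : Fin n → ℕ)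
    (z : Fin n → K) : K :=
  (Matrix.of fun j k : Fin n => h c α γ (μ j) (z k) - h c α γ (μ j) (z k)⁻¹).det

/-- The denominator `det (z_k^{n-j+1} - z_k^{-n+j-1})`, `1 ≤ j, k ≤ n`. -/
def denom {K : Type*} [Field K] {n : ℕ} (z : Fin n → K) : K :=
  (Matrix.of fun j k : Fin n =>
    z k ^ ((n : ℤ) - (j : ℤ)) - z k ^ (-((n : ℤ) - (j : ℤ)))).det

/-- The staircase `δ = (n-1, n-2, …, 0)`. -/
def staircase (n : ℕ) (j : Fin n) : ℕ := n - 1 - (j : ℕ)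

/-- `o⁺_l(z | α | γ | t)`, with `r` the chosen square root of `-t`. -/
def oPlus {K : Type*} [Field K] {n L : ℕ} (r : K) (α γ : Fin L → K) (l : Fin n → ℕ)
    (z : Fin n → K) : K :=
  H r α γ (l + staircase n) z / denom z

/-- `o⁻_l(z | α | γ | t)`, with `r` the chosen square root of `-t`. -/
def oMinus {K : Type*} [Field K] {n L : ℕ} (r : K) (α γ : Fin L → K) (l : Fin n → ℕ)
    (z : Fin n → K) : K :=
  H (-r) α γ (l + staircase n) z / denom z

/-- The Young diagrams `l ⊆ M^N`, i.e. sequences `M ≥ l_1 ≥ ⋯ ≥ l_N ≥ 0`. -/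
def boxPartitions (N M : ℕ) : Finset (Fin N → ℕ) :=
  {l ∈ Fintype.piFinset fun _ : Fin N => Finset.range (M + 1) |
    ∀ i j : Fin N, i ≤ j → l j ≤ l i}

/-- `l̂_i = |{j | l_j ≤ M - i}|` for `1 ≤ i ≤ M` (the index `i : Fin M` stands for `i + 1`). -/
def hat {N : ℕ} (M : ℕ) (l : Fin N → ℕ) (i : Fin M) : ℕ :=
  ({j : Fin N | l j ≤ M - ((i : ℕ) + 1)} : Finset (Fin N)).card

end DualCauchy

/-! The sum is a Laplace expansion of one determinant of size `L = N + M` in the variables `(x,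
-y)`. The rows `λ + δ_N` and `λ̂ + δ_M` partition `{0, …, L - 1}`, and `h_neg` turns the `y`-factor
with negated parameters into the block of columns at `-y`; this gives `sum_H_mul_H`.

The full determinant factors. For `μ < L`, `h_μ(z) - h_μ(z⁻¹)` is `z - z⁻¹` times a polynomial of
degree less than `L` in `w = z + z⁻¹`. With `L` rows and `L` variables the matrix is thus a
coefficient matrix times a Vandermonde matrix in `w`, up to column scaling, so it equals `coeffDet *
denom` (`H_staircase_eq`), where `coeffDet` does not depend on `z`.

The constant is found at `z = γ`, where the matrix is triangular (`H_id_self`, `coeffDet_eq`).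
Finally `denom` at `(x, -y)` splits into `denom x`, `denom y` and the cross factors of the formula
(`denom_append_neg`). -/

namespace DualCauchy

open Polynomial Finset

/-! ### Chebyshev polynomials in `z + z⁻¹` -/

section Chebyshev

variable (R : Type*) [CommRing R]

theorem natDegree_S_le (n : ℕ) : (Chebyshev.S R n).natDegree ≤ n := by
  induction n using Nat.twoStepInduction with
  | zero => simp
  | one => simpa using natDegree_X_le
  | more n ih1 ih2 =>
    have e : Chebyshev.S R ((n + 2 : ℕ) : ℤ) =
        X * Chebyshev.S R ((n + 1 : ℕ) : ℤ) - Chebyshev.S R (n : ℤ) := by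
      push_cast
      exact Chebyshev.S_add_two R n
    rw [e]
    refine (natDegree_sub_le _ _).trans (max_le ?_ (by omega))
    refine natDegree_mul_le.trans ?_
    have := natDegree_X_le (R := R)
    omega

theorem coeff_S_self (n : ℕ) : (Chebyshev.S R n).coeff n = 1 := by
  induction n using Nat.twoStepInduction with
  | zero => simp
  | one => simp
  | more n ih1 ih2 =>
    have e : Chebyshev.S R ((n + 2 : ℕ) : ℤ) =
        X * Chebyshev.S R ((n + 1 : ℕ) : ℤ) - Chebyshev.S R (n : ℤ) := by
      push_cast
      exact Chebyshev.S_add_two R n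
    rw [e, coeff_sub, coeff_X_mul, ih2,
      coeff_eq_zero_of_natDegree_lt ((natDegree_S_le R n).trans_lt (by omega)), sub_zero]

theorem monic_S (n : ℕ) : (Chebyshev.S R n).Monic :=
  monic_of_natDegree_le_of_coeff_eq_one n (natDegree_S_le R n) (coeff_S_self R n)

theorem natDegree_S [Nontrivial R] (n : ℕ) : (Chebyshev.S R n).natDegree = n :=
  natDegree_eq_of_le_of_coeff_ne_zero (natDegree_S_le R n) (by simp [coeff_S_self])

/-- Negative `m` reduces to positive `m` by the reflection `S_{-k-1} = -S_{k-1}`. -/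
theorem S_sub_one_mem_degreeLT {L : ℕ} {m : ℤ} (hm : m.natAbs ≤ L) :
    Chebyshev.S R (m - 1) ∈ degreeLT R L := by
  have key : ∀ k : ℕ, k ≤ L → Chebyshev.S R ((k : ℤ) - 1) ∈ degreeLT R L := by
    intro k hk
    cases k with
    | zero => simp
    | succ k =>
      have e : ((k + 1 : ℕ) : ℤ) - 1 = k := by push_cast; ring
      rw [e, mem_degreeLT]
      exact degree_le_natDegree.trans_lt
        (by exact_mod_cast (natDegree_S_le R k).trans_lt (by omega))
  obtain ⟨k, rfl | rfl⟩ := m.eq_nat_or_neg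
  · exact key k (by simpa using hm)
  · rw [Chebyshev.S_neg_sub_one]
    exact neg_mem (key k (by simpa using hm))

end Chebyshev

theorem zpow_sub_zpow_neg {K : Type*} [Field K] {z : K} (hz : z ≠ 0) (m : ℤ) :
    z ^ m - z ^ (-m) = (z - z⁻¹) * (Chebyshev.S K (m - 1)).eval (z + z⁻¹) := by
  suffices H : ∀ n : ℤ, (z - z⁻¹) * (Chebyshev.S K n).eval (z + z⁻¹) =
      z ^ n * z - (z ^ n)⁻¹ * z⁻¹ by
    rw [H, zpow_sub_one₀ hz, zpow_neg]
    field_simp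
  intro n
  have hzz : z * z⁻¹ = 1 := mul_inv_cancel₀ hz
  induction n using Chebyshev.induct with
  | zero => simp
  | one =>
    simp
    ring
  | add_two n ih1 ih2 =>
    rw [Chebyshev.S_add_two, eval_sub, eval_mul, eval_X,
      show (z - z⁻¹) * ((z + z⁻¹) * (Chebyshev.S K (n + 1)).eval (z + z⁻¹) -
        (Chebyshev.S K n).eval (z + z⁻¹)) =
        (z + z⁻¹) * ((z - z⁻¹) * (Chebyshev.S K (n + 1)).eval (z + z⁻¹)) -
        (z - z⁻¹) * (Chebyshev.S K n).eval (z + z⁻¹) by ring, ih1, ih2]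
    rw [zpow_add₀ hz, zpow_add₀ hz]
    norm_cast
    field_simp
    ring
  | neg_add_one n ih1 ih2 =>
    rw [Chebyshev.S_sub_one, eval_sub, eval_mul, eval_X,
      show (z - z⁻¹) * ((z + z⁻¹) * (Chebyshev.S K (-n : ℤ)).eval (z + z⁻¹) -
        (Chebyshev.S K (-n + 1 : ℤ)).eval (z + z⁻¹)) =
        (z + z⁻¹) * ((z - z⁻¹) * (Chebyshev.S K (-n : ℤ)).eval (z + z⁻¹)) -
        (z - z⁻¹) * (Chebyshev.S K (-n + 1 : ℤ)).eval (z + z⁻¹) by ring, ih1, ih2]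
    rw [zpow_sub_one₀ hz, zpow_add_one₀ hz]
    have : z ^ (-n : ℤ) ≠ 0 := zpow_ne_zero _ hz
    field_simp
    ring

/-! ### Antisymmetrization under `z ↦ z⁻¹` -/

section Antisymmetrization

variable {R : Type*} [CommRing R]

/-- The polynomial `Q` with `A(z) B(z⁻¹) - A(z⁻¹) B(z) = (z - z⁻¹) Q(z + z⁻¹)`,
for `A`, `B` of degree at most `L`. -/
noncomputable def antisym (L : ℕ) (A B : R[X]) : R[X] :=
  ∑ i ∈ range (L + 1), ∑ j ∈ range (L + 1),
    C (A.coeff i * B.coeff j) * Chebyshev.S R ((i : ℤ) - j - 1)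

theorem antisym_mem_degreeLT (L : ℕ) (A B : R[X]) : antisym L A B ∈ degreeLT R L := by
  refine sum_mem fun i hi => sum_mem fun j hj => ?_
  rw [← smul_eq_C_mul]
  refine Submodule.smul_mem _ _ (S_sub_one_mem_degreeLT R ?_)
  simp only [mem_range] at hi hj
  omega

theorem map_antisym {R' : Type*} [CommRing R'] (f : R →+* R') (L : ℕ) (A B : R[X]) :
    (antisym L A B).map f = antisym L (A.map f) (B.map f) := by
  simp [antisym, Polynomial.map_sum]

theorem eval_antisym {K : Type*} [Field K] {z : K} (hz : z ≠ 0) {L : ℕ} {A B : K[X]}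
    (hA : A.natDegree ≤ L) (hB : B.natDegree ≤ L) :
    A.eval z * B.eval z⁻¹ - A.eval z⁻¹ * B.eval z =
      (z - z⁻¹) * (antisym L A B).eval (z + z⁻¹) := by
  rw [eval_eq_sum_range' (Nat.lt_succ_of_le hA), eval_eq_sum_range' (Nat.lt_succ_of_le hA),
    eval_eq_sum_range' (Nat.lt_succ_of_le hB), eval_eq_sum_range' (Nat.lt_succ_of_le hB),
    sum_mul_sum, sum_mul_sum, ← sum_sub_distrib]
  simp only [antisym, eval_finsetSum, mul_sum, ← sum_sub_distrib, eval_mul, eval_C]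
  refine sum_congr rfl fun i _ => sum_congr rfl fun j _ => ?_
  have := zpow_sub_zpow_neg hz ((i : ℤ) - j)
  rw [mul_left_comm (z - z⁻¹), ← this, neg_sub, zpow_sub₀ hz, zpow_sub₀ hz]
  simp only [zpow_natCast, inv_pow]
  field_simp

theorem eval_eq_sum_fin_of_mem_degreeLT {L : ℕ} {p : R[X]} (hp : p ∈ degreeLT R L) (w : R) :
    p.eval w = ∑ m : Fin L, p.coeff m * w ^ (m : ℕ) := by
  rw [Fin.sum_univ_eq_sum_range (fun m => p.coeff m * w ^ m) L, eval_eq_sum, sum_def]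
  refine sum_subset (fun m hm => ?_) (fun m _ hm => by simp [notMem_support_iff.mp hm])
  rw [mem_degreeLT] at hp
  rw [mem_range]
  exact_mod_cast (le_degree_of_mem_supp m hm).trans_lt hp

end Antisymmetrization

/-! ### Factoring the full-size determinant -/

section HPolynomials

variable {R : Type*} [CommRing R] {L : ℕ}

/-- The polynomial `∏_j (1 - γ_j X)`. -/
noncomputable def gammaPoly (γ : Fin L → R) : R[X] := ∏ i : Fin L, (1 - C (γ i) * X)

/-- The factor of `h_μ(z)` that is polynomial in `z`. -/
noncomputable def hPoly (c : R) (α γ : Fin L → R) (μ : ℕ) : R[X] :=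
  (X + C c) *
    (∏ i ∈ univ.filter (fun i : Fin L => (i : ℕ) < μ), (C (α i) + C (1 - α i * γ i) * X)) *
    (∏ i ∈ univ.filter (fun i : Fin L => μ < (i : ℕ)), (1 - C (γ i) * X))

theorem natDegree_one_sub_C_mul_X_le (a : R) : (1 - C a * X).natDegree ≤ 1 := by
  compute_degree

theorem natDegree_gammaPoly_le (γ : Fin L → R) : (gammaPoly γ).natDegree ≤ L := by
  refine (natDegree_prod_le _ _).trans ((sum_le_card_nsmul _ _ 1 fun i _ =>
    natDegree_one_sub_C_mul_X_le _).trans ?_)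
  simp

/-- The two products skip the index `μ`, leaving `L - 1` linear factors besides `X + c`. -/
theorem natDegree_hPoly_le (c : R) (α γ : Fin L → R) {μ : ℕ} (hμ : μ < L) :
    (hPoly c α γ μ).natDegree ≤ L := by
  have h1 : (X + C c : R[X]).natDegree ≤ 1 := by compute_degree
  have h2 := (natDegree_prod_le (univ.filter (fun i : Fin L => (i : ℕ) < μ))
    (fun i => C (α i) + C (1 - α i * γ i) * X)).trans
    (sum_le_card_nsmul _ _ 1 fun i _ => by compute_degree)
  have h3 := (natDegree_prod_le (univ.filter (fun i : Fin L => μ < (i : ℕ)))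
    (fun i => 1 - C (γ i) * X)).trans
    (sum_le_card_nsmul _ _ 1 fun i _ => natDegree_one_sub_C_mul_X_le _)
  have hc : #(univ.filter (fun i : Fin L => (i : ℕ) < μ)) +
      #(univ.filter (fun i : Fin L => μ < (i : ℕ))) + 1 ≤ L := by
    have hd : Disjoint (univ.filter (fun i : Fin L => (i : ℕ) < μ))
        (univ.filter (fun i : Fin L => μ < (i : ℕ))) := by
      rw [disjoint_filter]; intros; omega
    rw [← card_union_of_disjoint hd, ← card_insert_of_notMem (a := (⟨μ, hμ⟩ : Fin L)) (by simp)]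
    exact (card_le_univ _).trans (by simp)
  unfold hPoly
  refine natDegree_mul_le.trans ?_
  have := natDegree_mul_le (p := X + C c) (q := ∏ i ∈ univ.filter (fun i : Fin L => (i : ℕ) < μ),
    (C (α i) + C (1 - α i * γ i) * X))
  simp only [smul_eq_mul, mul_one] at h2 h3
  omega

/-- The determinant of the coefficients of the polynomials `Q_μ` with
`h_μ(z) - h_μ(z⁻¹) = (z - z⁻¹) Q_μ(z + z⁻¹)`. -/
noncomputable def coeffDet (c : R) (α γ : Fin L → R) : R :=
  (Matrix.of fun μ m : Fin L => (antisym L (hPoly c α γ μ) (gammaPoly γ)).coeff m).det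

theorem map_coeffDet {R' : Type*} [CommRing R'] (f : R →+* R') (c : R) (α γ : Fin L → R) :
    f (coeffDet c α γ) = coeffDet (f c) (f ∘ α) (f ∘ γ) := by
  rw [coeffDet, RingHom.map_det, coeffDet]
  congr 1
  ext μ m
  simp only [RingHom.mapMatrix_apply, Matrix.map_apply, Matrix.of_apply, ← coeff_map, map_antisym]
  simp [hPoly, gammaPoly, Polynomial.map_prod]

theorem h_eq_eval {K : Type*} [Field K] (c : K) (α γ : Fin L → K) (μ : ℕ) (z : K) :
    h c α γ μ z = (hPoly c α γ μ).eval z * (gammaPoly γ).eval z⁻¹ := by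
  simp [h, hPoly, gammaPoly, eval_prod]

theorem h_sub_h_inv {K : Type*} [Field K] (c : K) (α γ : Fin L → K) {μ : ℕ} (hμ : μ < L) {z : K}
    (hz : z ≠ 0) :
    h c α γ μ z - h c α γ μ z⁻¹ =
      (z - z⁻¹) * (antisym L (hPoly c α γ μ) (gammaPoly γ)).eval (z + z⁻¹) := by
  rw [h_eq_eval, h_eq_eval, inv_inv,
    eval_antisym hz (natDegree_hPoly_le c α γ hμ) (natDegree_gammaPoly_le γ)]

theorem H_id_eq {K : Type*} [Field K] (c : K) (α γ : Fin L → K) {z : Fin L → K}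
    (hz : ∀ k, z k ≠ 0) :
    H c α γ (fun j : Fin L => (j : ℕ)) z = coeffDet c α γ *
      ((∏ k, (z k - (z k)⁻¹)) * ∏ i, ∏ j ∈ Ioi i, (z j + (z j)⁻¹ - (z i + (z i)⁻¹))) := by
  rw [← Matrix.det_vandermonde (fun k => z k + (z k)⁻¹), coeffDet, mul_left_comm,
    ← Matrix.det_transpose (Matrix.vandermonde _), ← Matrix.det_mul, ← Matrix.det_mul_row, H]
  congr 1
  ext j k
  simp only [Matrix.of_apply, Matrix.mul_apply, Matrix.transpose_apply, Matrix.vandermonde_apply]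
  rw [h_sub_h_inv c α γ j.2 (hz k), eval_eq_sum_fin_of_mem_degreeLT (antisym_mem_degreeLT _ _ _)]

theorem sign_revPerm (n : ℕ) {A : Type*} [CommRing A] :
    (((Equiv.Perm.sign (Fin.revPerm : Equiv.Perm (Fin n)) : ℤˣ) : ℤ) : A) =
      ∏ i : Fin n, ∏ _j ∈ Ioi i, (-1 : A) := by
  rw [Equiv.Perm.sign_eq_prod_prod_Ioi]
  push_cast
  refine prod_congr rfl fun i _ => prod_congr rfl fun j hj => ?_
  rw [mem_Ioi] at hj
  simp [Fin.revPerm_apply, not_lt.mpr hj.le]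

/-- After removing `z_k - z_k⁻¹` from each column, the rows are monic polynomials in `z + z⁻¹` of
degrees `L - 1, …, 0`: a Vandermonde determinant with its rows reversed. -/
theorem denom_eq {K : Type*} [Field K] {z : Fin L → K} (hz : ∀ k, z k ≠ 0) :
    denom z = (∏ k, (z k - (z k)⁻¹)) *
      ∏ i, ∏ j ∈ Ioi i, (z i + (z i)⁻¹ - (z j + (z j)⁻¹)) := by
  have h1 : ∏ i, ∏ j ∈ Ioi i, (z i + (z i)⁻¹ - (z j + (z j)⁻¹)) =
      (((Equiv.Perm.sign (Fin.revPerm : Equiv.Perm (Fin L)) : ℤˣ) : ℤ) : K) *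
        (Matrix.vandermonde (fun k => z k + (z k)⁻¹)).det := by
    rw [sign_revPerm, Matrix.det_vandermonde, ← prod_mul_distrib]
    refine prod_congr rfl fun i _ => ?_
    rw [← prod_mul_distrib]
    exact prod_congr rfl fun j _ => by ring
  rw [h1, Matrix.det_eval_matrixOfPolynomials_eq_det_vandermonde _
    (fun i : Fin L => Chebyshev.S K (i : ℕ)) (fun i => natDegree_S K i) (fun i => monic_S K i),
    ← Matrix.det_transpose, ← Matrix.det_permute, ← Matrix.det_mul_row, denom]
  congr 1
  ext j k
  simp only [Matrix.of_apply, Matrix.submatrix_apply, Matrix.transpose_apply, Fin.revPerm_apply,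
    id]
  rw [zpow_sub_zpow_neg (hz k)]
  congr 3
  have := j.2
  rw [Fin.val_rev]
  omega

/-- Reversing the rows of `H` produces the same sign as in `denom_eq`, so no sign survives. -/
theorem H_staircase_eq {K : Type*} [Field K] (c : K) (α γ : Fin L → K) {z : Fin L → K}
    (hz : ∀ k, z k ≠ 0) : H c α γ (staircase L) z = coeffDet c α γ * denom z := by
  have h1 : H c α γ (staircase L) z =
      (((Equiv.Perm.sign (Fin.revPerm : Equiv.Perm (Fin L)) : ℤˣ) : ℤ) : K) *
        H c α γ (fun j : Fin L => (j : ℕ)) z := by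
    rw [H, H, ← Matrix.det_permute]
    congr 1
    ext j k
    have : staircase L j = (Fin.rev j : ℕ) := by
      rw [staircase, Fin.val_rev]; omega
    simp [this]
  rw [h1, H_id_eq c α γ hz, denom_eq hz, sign_revPerm, mul_left_comm, mul_left_comm (∏ i, _),
    ← prod_mul_distrib]
  congr 2
  refine prod_congr rfl fun i _ => ?_
  rw [← prod_mul_distrib]
  exact prod_congr rfl fun j _ => by ring

end HPolynomials

/-! ### Evaluation of the constant `coeffDet` -/

section CoeffDet

variable {L : ℕ}

theorem prod_prod_Iio_eq_prod_prod_Ioi {A : Type*} [CommMonoid A] (f : Fin L → Fin L → A) :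
    ∏ k, ∏ i ∈ Iio k, f i k = ∏ i, ∏ k ∈ Ioi i, f i k :=
  prod_comm' (by simp)

theorem prod_univ_eq_Iio_mul_Ioi {A : Type*} [CommMonoid A] (f : Fin L → A) (k : Fin L) :
    ∏ i, f i = f k * ((∏ i ∈ Iio k, f i) * ∏ i ∈ Ioi k, f i) := by
  have hd : Disjoint (Iio k) (Ioi k) :=
    disjoint_left.mpr fun i h1 h2 => (mem_Iio.mp h1).not_gt (mem_Ioi.mp h2)
  rw [← prod_union hd, ← prod_insert (by simp)]
  congr 1
  ext i
  have := lt_trichotomy i k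
  simp only [mem_univ, mem_insert, mem_union, mem_Iio, mem_Ioi, true_iff]
  tauto

/-- At `z = γ` the matrix of `H` is triangular. -/
theorem H_id_self {K : Type*} [Field K] (c : K) (α γ : Fin L → K) (hγ : ∀ k, γ k ≠ 0) :
    H c α γ (fun j : Fin L => (j : ℕ)) γ =
      ∏ k, -(((γ k)⁻¹ + c) * (∏ i ∈ Iio k, (α i + (1 - α i * γ i) * (γ k)⁻¹)) *
        (∏ i ∈ Ioi k, (1 - γ i * (γ k)⁻¹)) * ∏ i, (1 - γ i * γ k)) := by
  -- The factor `1 - γ_k z⁻¹` vanishes at `z = γ_k`, so only the term `h_μ(γ_k⁻¹)` remains.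
  have h0 : ∀ μ k, h c α γ μ (γ k) = 0 := fun μ k => by
    rw [h, prod_eq_zero (i := k) (mem_univ _) (by simp [hγ k]), mul_zero]
  rw [H, Matrix.det_of_isLowerTriangular]
  · refine prod_congr rfl fun k _ => ?_
    rw [Matrix.of_apply, h0, zero_sub, h, inv_inv]
    congr 4
    · congr 1
      ext i
      simp
    · ext i
      simp
  · intro i j hij
    have hij' : i < j := hij
    have hj : ∏ k ∈ univ.filter (fun k : Fin L => (i : ℕ) < k), (1 - γ k * (γ j)⁻¹) = 0 :=
      prod_eq_zero (i := j) (by simpa using hij') (by simp [hγ j])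
    rw [Matrix.of_apply, h0, zero_sub, h, hj, mul_zero, zero_mul, neg_zero]

/-- Compares the two evaluations of `H` at `z = γ`. It is left as a vanishing product because the
second factor may be zero for special `γ`. -/
theorem coeffDet_mul_eq {K : Type*} [Field K] (c : K) (α γ : Fin L → K) (hγ : ∀ k, γ k ≠ 0) :
    (coeffDet c α γ - (∏ j, (1 + c * γ j)) * (∏ j, ∏ k ∈ Ioi j, (1 + α j * (γ k - γ j))) *
      ∏ j, ∏ k ∈ Ioi j, (1 - γ j * γ k)) *
      ((∏ k, (γ k - (γ k)⁻¹)) * ∏ i, ∏ j ∈ Ioi i, (γ j + (γ j)⁻¹ - (γ i + (γ i)⁻¹))) = 0 := by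
  rw [sub_mul, ← H_id_eq c α γ hγ, H_id_self c α γ hγ, sub_eq_zero]
  have h1 : ∀ k, -(((γ k)⁻¹ + c) * (∏ i ∈ Iio k, (α i + (1 - α i * γ i) * (γ k)⁻¹)) *
        (∏ i ∈ Ioi k, (1 - γ i * (γ k)⁻¹)) * ∏ i, (1 - γ i * γ k)) =
      ((1 + c * γ k) * (γ k - (γ k)⁻¹)) *
        ((∏ i ∈ Iio k, (α i + (1 - α i * γ i) * (γ k)⁻¹) * (1 - γ i * γ k)) *
        (∏ i ∈ Ioi k, (1 - γ i * (γ k)⁻¹) * (1 - γ i * γ k))) := by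
    intro k
    rw [prod_univ_eq_Iio_mul_Ioi _ k, prod_mul_distrib, prod_mul_distrib]
    -- The diagonal factor `1 - γ_k²` combines with `γ_k⁻¹ + c`; the off-diagonal factors are
    -- regrouped by pairs `j < k`.
    have : -(((γ k)⁻¹ + c) * (1 - γ k * γ k)) = (1 + c * γ k) * (γ k - (γ k)⁻¹) := by
      have := hγ k
      field_simp
      ring
    rw [← this]
    ring
  simp_rw [h1]
  rw [prod_mul_distrib, prod_mul_distrib, prod_mul_distrib,
    prod_prod_Iio_eq_prod_prod_Ioi
      (fun i k => (α i + (1 - α i * γ i) * (γ k)⁻¹) * (1 - γ i * γ k)),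
    ← prod_mul_distrib
      (f := fun i => ∏ k ∈ Ioi i, (α i + (1 - α i * γ i) * (γ k)⁻¹) * (1 - γ i * γ k))]
  have h2 : ∀ j, (∏ k ∈ Ioi j, (α j + (1 - α j * γ j) * (γ k)⁻¹) * (1 - γ j * γ k)) *
      (∏ k ∈ Ioi j, (1 - γ k * (γ j)⁻¹) * (1 - γ k * γ j)) =
      (∏ k ∈ Ioi j, (1 + α j * (γ k - γ j))) * ((∏ k ∈ Ioi j, (1 - γ j * γ k)) *
        ∏ k ∈ Ioi j, (γ k + (γ k)⁻¹ - (γ j + (γ j)⁻¹))) := by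
    intro j
    simp_rw [← prod_mul_distrib]
    refine prod_congr rfl fun k _ => ?_
    have := hγ k
    have := hγ j
    field_simp
    ring
  rw [prod_congr rfl fun j _ => h2 j, prod_mul_distrib, prod_mul_distrib]
  ring

theorem prod_sub_inv_mul_prod_ne_zero {K : Type*} [Field K] {z : Fin L → K} (hz : ∀ k, z k ≠ 0)
    (hzz : ∀ j k, z j * z k ≠ 1) (hinj : Function.Injective z) :
    (∏ k, (z k - (z k)⁻¹)) *
      ∏ i, ∏ j ∈ Ioi i, (z j + (z j)⁻¹ - (z i + (z i)⁻¹)) ≠ 0 := by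
  refine mul_ne_zero (prod_ne_zero_iff.mpr fun k _ h0 => hzz k k ?_)
    (prod_ne_zero_iff.mpr fun i _ => prod_ne_zero_iff.mpr fun j hj => ?_)
  · nth_rewrite 2 [sub_eq_zero.mp h0]
    exact mul_inv_cancel₀ (hz k)
  · have h1 : z j + (z j)⁻¹ - (z i + (z i)⁻¹) =
        (z j - z i) * (z i * z j - 1) / (z i * z j) := by
      have := hz i
      have := hz j
      field_simp
      ring
    rw [h1]
    exact div_ne_zero (mul_ne_zero (sub_ne_zero.mpr fun h0 => (mem_Ioi.mp hj).ne' (hinj h0))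
      (sub_ne_zero.mpr (hzz i j))) (mul_ne_zero (hz i) (hz j))

/-- Both sides are polynomial in `γ`. For indeterminate `γ`, over the fraction field, the extra
factor of `coeffDet_mul_eq` is nonzero and cancels; specialization gives every `γ`, including zero
or repeated entries. -/
theorem coeffDet_eq {K : Type*} [Field K] (c : K) (α γ : Fin L → K) :
    coeffDet c α γ = (∏ j, (1 + c * γ j)) * (∏ j, ∏ k ∈ Ioi j, (1 + α j * (γ k - γ j))) *
      ∏ j, ∏ k ∈ Ioi j, (1 - γ j * γ k) := by
  let R := MvPolynomial (Fin L) K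
  let F := FractionRing R
  let x : Fin L → R := MvPolynomial.X
  let φ : R →+* F := algebraMap R F
  have hφ : Function.Injective φ := IsFractionRing.injective R F
  have hgen : coeffDet (MvPolynomial.C c : R) (MvPolynomial.C ∘ α) x =
      (∏ j, (1 + MvPolynomial.C c * x j)) *
        (∏ j, ∏ k ∈ Ioi j, (1 + MvPolynomial.C (α j) * (x k - x j))) *
        ∏ j, ∏ k ∈ Ioi j, (1 - x j * x k) := by
    have hx : ∀ k, φ (x k) ≠ 0 := fun k =>
      (map_ne_zero_iff φ hφ).mpr (MvPolynomial.X_ne_zero k)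
    have hxx : ∀ j k, φ (x j) * φ (x k) ≠ 1 := by
      intro j k hjk
      rw [← map_mul, ← map_one φ] at hjk
      simpa [x] using congrArg (MvPolynomial.eval (0 : Fin L → K)) (hφ hjk)
    apply hφ
    have key := coeffDet_mul_eq (φ (MvPolynomial.C c)) (φ ∘ MvPolynomial.C ∘ α) (φ ∘ x) hx
    rw [← map_coeffDet] at key
    have hne : (∏ k, ((φ ∘ x) k - ((φ ∘ x) k)⁻¹)) * ∏ i, ∏ j ∈ Ioi i,
        ((φ ∘ x) j + ((φ ∘ x) j)⁻¹ - ((φ ∘ x) i + ((φ ∘ x) i)⁻¹)) ≠ 0 :=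
      prod_sub_inv_mul_prod_ne_zero hx hxx (hφ.comp MvPolynomial.X_injective)
    rw [sub_eq_zero.mp ((mul_eq_zero.mp key).resolve_right hne)]
    simp [map_prod]
  have h := congrArg (MvPolynomial.eval γ) hgen
  rw [map_coeffDet] at h
  simp only [map_mul, map_prod, map_add, map_sub, map_one, MvPolynomial.eval_C] at h
  have e1 : (MvPolynomial.eval γ : R → K) ∘ MvPolynomial.C ∘ α = α := by ext; simp
  have e2 : (MvPolynomial.eval γ : R → K) ∘ x = γ := by ext; simp [x]
  rw [e1, e2] at h
  simpa [x] using h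

end CoeffDet

/-! ### The denominator at `(x, -y)` -/

theorem prod_prod_Ioi_fin_add {A : Type*} [CommMonoid A] {N M : ℕ}
    (f : Fin (N + M) → Fin (N + M) → A) :
    ∏ i, ∏ j ∈ Ioi i, f i j =
      (∏ i : Fin N, ∏ j ∈ Ioi i, f (Fin.castAdd M i) (Fin.castAdd M j)) *
      (∏ i : Fin N, ∏ j : Fin M, f (Fin.castAdd M i) (Fin.natAdd N j)) *
      (∏ i : Fin M, ∏ j ∈ Ioi i, f (Fin.natAdd N i) (Fin.natAdd N j)) := by
  have e : ∀ {n : ℕ} (i : Fin n) (g : Fin n → A), ∏ j ∈ Ioi i, g j =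
      ∏ j, if i < j then g j else 1 := fun i g => by
    rw [← prod_filter]
    congr 1
    ext; simp
  have h1 : ∀ (i : Fin N) (j : Fin M), Fin.castAdd M i < Fin.natAdd N j := fun i j => by
    rw [Fin.lt_def, Fin.val_castAdd, Fin.val_natAdd]; omega
  have h2 : ∀ i j : Fin N, Fin.castAdd M i < Fin.castAdd M j ↔ i < j := fun _ _ => Iff.rfl
  simp_rw [e, Fin.prod_univ_add, ← prod_mul_distrib]
  simp [h1, h2, fun i j => (h1 i j).not_gt, prod_mul_distrib]

/-- A cross pair contributes `x + x⁻¹ + y + y⁻¹ = y⁻¹ (1 + x y)(1 + x⁻¹ y)`. Replacing `y` by `-y`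
scales row `k` of `denom y` by `(-1) ^ (M - k)`. -/
theorem denom_append_neg {K : Type*} [Field K] {N M : ℕ} {x : Fin N → K} {y : Fin M → K}
    (hx : ∀ j, x j ≠ 0) (hy : ∀ k, y k ≠ 0) :
    denom (Fin.append x (-y)) = denom x * ((∏ k : Fin M, (-1) ^ (M - (k : ℕ))) * denom y) *
      ((∏ k, y k ^ (-(N : ℤ))) * ∏ j, ∏ k, (1 + x j * y k) * (1 + (x j)⁻¹ * y k)) := by
  have hz : ∀ k, Fin.append x (-y) k ≠ 0 := by
    intro k
    induction k using Fin.addCases <;> simp [hx, hy]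
  have hneg : (∏ k : Fin M, (-1) ^ (M - (k : ℕ))) * denom y = denom (-y) := by
    rw [denom, denom, ← Matrix.det_mul_column]
    congr 1
    ext j k
    have : (M : ℤ) - (j : ℤ) = ((M - (j : ℕ) : ℕ) : ℤ) := by have := j.2; omega
    simp only [Matrix.of_apply, Pi.neg_apply, this, zpow_neg, zpow_natCast, neg_pow (y k), mul_inv,
      ← inv_pow (-1 : K), inv_neg, inv_one]
    ring
  have hcross : (∏ k, y k ^ (-(N : ℤ))) * ∏ j, ∏ k, (1 + x j * y k) * (1 + (x j)⁻¹ * y k) =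
      ∏ j, ∏ k, (x j + (x j)⁻¹ + (y k + (y k)⁻¹)) := by
    have : ∏ k, y k ^ (-(N : ℤ)) = ∏ _j : Fin N, ∏ k, (y k)⁻¹ := by
      simp [prod_pow]
    rw [this, ← prod_mul_distrib]
    refine prod_congr rfl fun j _ => ?_
    rw [← prod_mul_distrib]
    refine prod_congr rfl fun k _ => ?_
    have := hx j
    have := hy k
    field_simp
    ring
  rw [hneg, denom_eq hz, denom_eq hx, denom_eq (z := -y) (by simpa using hy), hcross,
    prod_prod_Ioi_fin_add,
    Fin.prod_univ_add]
  simp only [Fin.append_left, Fin.append_right, Pi.neg_apply, inv_neg]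
  have : ∀ j k, x j + (x j)⁻¹ - (-y k + -(y k)⁻¹) = x j + (x j)⁻¹ + (y k + (y k)⁻¹) := by
    intros; ring
  simp only [this]
  ring

/-! ### Laplace expansion indexed by partitions in a box -/

section Laplace

variable {N M : ℕ}

theorem mem_boxPartitions {l : Fin N → ℕ} :
    l ∈ boxPartitions N M ↔ (∀ j, l j ≤ M) ∧ Antitone l := by
  simp [boxPartitions, Fintype.mem_piFinset, Antitone]

theorem hat_le (l : Fin N → ℕ) (i : Fin M) : hat M l i ≤ N :=
  (card_le_univ _).trans (by simp)

theorem hat_antitone (l : Fin N → ℕ) : Antitone (hat M l) := by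
  intro i i' hii
  refine card_le_card fun j hj => ?_
  simp only [mem_filter, mem_univ, true_and] at hj ⊢
  have : (i : ℕ) ≤ i' := hii
  omega

theorem le_hat {l : Fin N → ℕ} (hl : Antitone l) {i : Fin M} {j : Fin N}
    (hj : l j ≤ M - ((i : ℕ) + 1)) : N - (j : ℕ) ≤ hat M l i := by
  have : (Ici j).card ≤ hat M l i := by
    refine card_le_card fun j' hj' => ?_
    simp only [mem_filter, mem_univ, true_and]
    exact (hl (mem_Ici.mp hj')).trans hj
  simpa using this

theorem hat_le_sub {l : Fin N → ℕ} (hl : Antitone l) {i : Fin M} {j : Fin N}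
    (hj : M - ((i : ℕ) + 1) < l j) : hat M l i ≤ N - 1 - (j : ℕ) := by
  have : hat M l i ≤ (Ioi j).card := by
    refine card_le_card fun j' hj' => ?_
    simp only [mem_filter, mem_univ, true_and] at hj'
    by_contra hlt
    have := hl (not_lt.mp (fun h => hlt (mem_Ioi.mpr h)))
    omega
  simpa using this

/-- The rows of a square matrix of size `N + M` attached to `l`: first those of the parts of `l`,
then the complementary ones. -/
def boxRow (l : Fin N → ℕ) : Fin (N + M) → Fin (N + M) :=
  Fin.addCases (fun j => ⟨M - l j + j, by omega⟩) (fun i => ⟨N - hat M l i + i, by omega⟩)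

@[simp]
theorem boxRow_castAdd (l : Fin N → ℕ) (j : Fin N) :
    (boxRow l (Fin.castAdd M j) : ℕ) = M - l j + j := by
  simp [boxRow]

@[simp]
theorem boxRow_natAdd (l : Fin N → ℕ) (i : Fin M) :
    (boxRow l (Fin.natAdd N i) : ℕ) = N - hat M l i + i := by
  simp [boxRow]

theorem boxRow_castAdd_lt {l : Fin N → ℕ} (hl : Antitone l) {j j' : Fin N} (hj : j < j') :
    boxRow l (Fin.castAdd M j) < boxRow l (Fin.castAdd M j') := by
  rw [Fin.lt_def, boxRow_castAdd, boxRow_castAdd]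
  have h1 := hl hj.le
  have h2 : (j : ℕ) < j' := hj
  omega

theorem boxRow_natAdd_lt (l : Fin N → ℕ) {i i' : Fin M} (hi : i < i') :
    boxRow l (Fin.natAdd N i) < boxRow l (Fin.natAdd N i') := by
  rw [Fin.lt_def, boxRow_natAdd, boxRow_natAdd]
  have h1 := hat_antitone (M := M) l hi.le
  have h2 : (i : ℕ) < i' := hi
  omega

theorem boxRow_natAdd_lt_castAdd {l : Fin N → ℕ} (hl : Antitone l) {i : Fin M} {j : Fin N}
    (hj : l j ≤ M - ((i : ℕ) + 1)) :
    boxRow l (Fin.natAdd N i) < boxRow l (Fin.castAdd M j) := by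
  rw [Fin.lt_def, boxRow_castAdd, boxRow_natAdd]
  have := le_hat hl hj
  omega

theorem boxRow_castAdd_lt_natAdd {l : Fin N → ℕ} (hl : Antitone l) {i : Fin M} {j : Fin N}
    (hj : M - ((i : ℕ) + 1) < l j) :
    boxRow l (Fin.castAdd M j) < boxRow l (Fin.natAdd N i) := by
  rw [Fin.lt_def, boxRow_castAdd, boxRow_natAdd]
  have := hat_le_sub hl hj
  omega

theorem boxRow_injective {l : Fin N → ℕ} (hl : Antitone l) :
    Function.Injective (boxRow (M := M) l) := by
  have hcross : ∀ (j : Fin N) (i : Fin M),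
      boxRow l (Fin.castAdd M j) ≠ boxRow l (Fin.natAdd N i) := fun j i => by
    rcases le_or_gt (l j) (M - ((i : ℕ) + 1)) with h | h
    · exact (boxRow_natAdd_lt_castAdd hl h).ne'
    · exact (boxRow_castAdd_lt_natAdd hl h).ne
  intro a b hab
  induction a using Fin.addCases with
  | left j =>
    induction b using Fin.addCases with
    | left j' =>
      rcases lt_trichotomy j j' with h | h | h
      · exact absurd hab (boxRow_castAdd_lt hl h).ne
      · rw [h]
      · exact absurd hab (boxRow_castAdd_lt hl h).ne'
    | right i => exact absurd hab (hcross j i)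
  | right i =>
    induction b using Fin.addCases with
    | left j => exact absurd hab.symm (hcross j i)
    | right i' =>
      rcases lt_trichotomy i i' with h | h | h
      · exact absurd hab (boxRow_natAdd_lt l h).ne
      · rw [h]
      · exact absurd hab (boxRow_natAdd_lt l h).ne'

open Classical in
/-- `boxRow l` as a permutation. -/
noncomputable def boxPerm (l : Fin N → ℕ) : Equiv.Perm (Fin (N + M)) :=
  if hl : Antitone l then
    Equiv.ofBijective (boxRow l) (Finite.injective_iff_bijective.mp (boxRow_injective hl))
  else 1

theorem boxPerm_apply {l : Fin N → ℕ} (hl : Antitone l) (a : Fin (N + M)) :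
    boxPerm l a = boxRow l a := by
  simp [boxPerm, hl]

/-- Each block is increasing, so inversions occur only between blocks. The pair `(j, i)` is inverted
exactly when `l j ≤ M - (i + 1)`, the condition counted by `hat M l i`. -/
theorem sign_boxPerm {l : Fin N → ℕ} (hl : Antitone l) :
    Equiv.Perm.sign (boxPerm (M := M) l) = ∏ i : Fin M, (-1) ^ hat M l i := by
  rw [Equiv.Perm.sign_eq_prod_prod_Ioi, prod_prod_Ioi_fin_add]
  simp only [boxPerm_apply hl]
  rw [prod_eq_one fun j _ => prod_eq_one fun j' hj' =>
      if_pos (boxRow_castAdd_lt hl (mem_Ioi.mp hj')), one_mul, mul_comm,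
    prod_eq_one fun i _ => prod_eq_one fun i' hi' =>
      if_pos (boxRow_natAdd_lt l (mem_Ioi.mp hi')), one_mul, prod_comm]
  refine prod_congr rfl fun i _ => ?_
  rw [hat, ← prod_const, prod_filter]
  refine prod_congr rfl fun j _ => ?_
  rcases le_or_gt (l j) (M - ((i : ℕ) + 1)) with h | h
  · rw [if_pos h, if_neg (boxRow_natAdd_lt_castAdd hl h).not_gt]
  · rw [if_neg h.not_ge, if_pos (boxRow_castAdd_lt_natAdd hl h)]

/-- The permutation of `Fin (N + M)` acting blockwise. -/
def blockPerm (p : Equiv.Perm (Fin N)) (q : Equiv.Perm (Fin M)) : Equiv.Perm (Fin (N + M)) :=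
  finSumFinEquiv.permCongr (Equiv.sumCongr p q)

@[simp]
theorem blockPerm_castAdd (p : Equiv.Perm (Fin N)) (q : Equiv.Perm (Fin M)) (j : Fin N) :
    blockPerm p q (Fin.castAdd M j) = Fin.castAdd M (p j) := by
  simp [blockPerm, Equiv.permCongr_apply]

@[simp]
theorem blockPerm_natAdd (p : Equiv.Perm (Fin N)) (q : Equiv.Perm (Fin M)) (i : Fin M) :
    blockPerm p q (Fin.natAdd N i) = Fin.natAdd N (q i) := by
  simp [blockPerm, Equiv.permCongr_apply]

theorem sign_blockPerm (p : Equiv.Perm (Fin N)) (q : Equiv.Perm (Fin M)) :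
    Equiv.Perm.sign (blockPerm p q) = Equiv.Perm.sign p * Equiv.Perm.sign q := by
  rw [blockPerm, Equiv.Perm.sign_permCongr, Equiv.Perm.sign_sumCongr]

theorem blockPerm_injective {p p' : Equiv.Perm (Fin N)} {q q' : Equiv.Perm (Fin M)}
    (h : blockPerm p q = blockPerm p' q') : p = p' ∧ q = q' := by
  constructor <;> ext i
  · have := congrArg (fun σ => ((σ (Fin.castAdd M i) : Fin (N + M)) : ℕ)) h
    simpa using this
  · have := congrArg (fun σ => ((σ (Fin.natAdd N i) : Fin (N + M)) : ℕ)) h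
    simpa using this

theorem exists_blockPerm_eq {τ : Equiv.Perm (Fin (N + M))}
    (h : ∀ j : Fin N, ∃ j' : Fin N, τ (Fin.castAdd M j) = Fin.castAdd M j') :
    ∃ p q, blockPerm p q = τ := by
  have : finSumFinEquiv.symm.permCongr τ ∈ (Equiv.Perm.sumCongrHom (Fin N) (Fin M)).range := by
    refine Equiv.Perm.mem_sumCongrHom_range_of_perm_mapsTo_inl ?_
    rintro _ ⟨j, rfl⟩
    obtain ⟨j', hj'⟩ := h j
    exact ⟨j', by simp [Equiv.permCongr_apply, hj']⟩
  obtain ⟨⟨p, q⟩, hpq⟩ := this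
  refine ⟨p, q, ?_⟩
  have hpq' : Equiv.sumCongr p q = finSumFinEquiv.symm.permCongr τ := hpq
  rw [blockPerm, hpq']
  ext
  simp [Equiv.permCongr_apply]

theorem add_sub_le_of_strictMono {n L : ℕ} {a : Fin n → Fin L} (ha : StrictMono a) {i j : Fin n}
    (hij : i ≤ j) : (a i : ℕ) + (j - i) ≤ a j := by
  obtain ⟨i, hi⟩ := i
  obtain ⟨j, hj⟩ := j
  obtain ⟨d, rfl⟩ := Nat.exists_eq_add_of_le (show i ≤ j from hij)
  induction d with
  | zero => simp
  | succ d ih =>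
    have h1 := ih (by omega) (by simp)
    have h2 : a ⟨i + d, by omega⟩ < a ⟨i + (d + 1), hj⟩ := ha (by simp)
    rw [Fin.lt_def] at h2
    simp only at h1 h2 ⊢
    omega

theorem exists_boxRow_eq {a : Fin N → Fin (N + M)} (ha : StrictMono a) :
    ∃ l ∈ boxPartitions N M, ∀ j, boxRow l (Fin.castAdd M j) = a j := by
  have h1 : ∀ j : Fin N, (j : ℕ) ≤ a j := fun j => by
    have := add_sub_le_of_strictMono ha (i := (⟨0, j.pos⟩ : Fin N)) (j := j) (by simp [Fin.le_def])
    simp only at this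
    omega
  have h2 : ∀ j : Fin N, (a j : ℕ) ≤ M + j := fun j => by
    have := add_sub_le_of_strictMono ha (i := j) (j := (⟨N - 1, by have := j.2; omega⟩ : Fin N))
      (by simp [Fin.le_def]; omega)
    simp only at this
    omega
  -- Solves `M - l j + j = a j`; the bounds `j ≤ a j ≤ M + j` make the truncated subtractions exact.
  refine ⟨fun j => M + j - a j, mem_boxPartitions.mpr ⟨fun j => ?_, fun i j hij => ?_⟩,
    fun j => ?_⟩
  · have := h1 j
    omega
  · have := add_sub_le_of_strictMono ha hij
    have : (i : ℕ) ≤ j := hij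
    have := h1 i
    have := h1 j
    simp only
    omega
  · have := h1 j
    have := h2 j
    rw [Fin.ext_iff, boxRow_castAdd]
    omega

/-- Laplace expansion of a determinant along its first `N` columns, with the sets of `N` rows
parametrized by the partitions in a box. -/
theorem det_eq_sum_boxPartitions {A : Type*} [CommRing A]
    (B : Matrix (Fin (N + M)) (Fin (N + M)) A) :
    B.det = ∑ l ∈ boxPartitions N M, (∏ i : Fin M, (-1) ^ hat M l i) *
      (Matrix.of fun j k : Fin N => B (boxRow l (Fin.castAdd M j)) (Fin.castAdd M k)).det *
      (Matrix.of fun i k : Fin M => B (boxRow l (Fin.natAdd N i)) (Fin.natAdd N k)).det := by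
  have hterm : ∀ l ∈ boxPartitions N M, (∏ i : Fin M, (-1) ^ hat M l i) *
      (Matrix.of fun j k : Fin N => B (boxRow l (Fin.castAdd M j)) (Fin.castAdd M k)).det *
      (Matrix.of fun i k : Fin M => B (boxRow l (Fin.natAdd N i)) (Fin.natAdd N k)).det =
      ∑ pq : Equiv.Perm (Fin N) × Equiv.Perm (Fin M),
        ((Equiv.Perm.sign (boxPerm l * blockPerm pq.1 pq.2 : Equiv.Perm (Fin (N + M))) : ℤ) : A) *
          ∏ k, B ((boxPerm l * blockPerm pq.1 pq.2 : Equiv.Perm (Fin (N + M))) k) k := by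
    intro l hl
    have hl' := (mem_boxPartitions.mp hl).2
    rw [Matrix.det_apply', Matrix.det_apply', mul_assoc, sum_mul_sum, ← sum_product', mul_sum]
    refine sum_congr rfl fun pq _ => ?_
    rw [map_mul, sign_blockPerm, sign_boxPerm hl', Fin.prod_univ_add]
    simp only [Equiv.Perm.mul_apply, blockPerm_castAdd, blockPerm_natAdd, boxPerm_apply hl',
      Matrix.of_apply]
    push_cast
    ring
  rw [sum_congr rfl hterm, Matrix.det_apply', ← sum_product']
  symm
  -- Each permutation factors uniquely as `boxPerm l * blockPerm p q`: `l` records the set of rows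
  -- matched with the first `N` columns, and `p`, `q` the matching inside each block.
  refine sum_nbij (fun s => boxPerm s.1 * blockPerm s.2.1 s.2.2) (fun _ _ => mem_univ _)
    ?_ ?_ (fun _ _ => rfl)
  · rintro ⟨l, p, q⟩ hs ⟨l', p', q'⟩ hs' h
    simp only [coe_product, coe_univ, Set.mem_prod, Set.mem_univ, and_true, mem_coe] at hs hs'
    obtain ⟨hb, hl⟩ := mem_boxPartitions.mp hs
    obtain ⟨hb', hl'⟩ := mem_boxPartitions.mp hs'
    simp only at h
    have hrow : (fun j => boxRow (M := M) l (Fin.castAdd M j)) =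
        fun j => boxRow l' (Fin.castAdd M j) := by
      have hr : ∀ {l : Fin N → ℕ} (_ : Antitone l) (p : Equiv.Perm (Fin N))
          (q : Equiv.Perm (Fin M)), Set.range (fun j => boxRow (M := M) l (Fin.castAdd M j)) =
          Set.range (fun j => (boxPerm l * blockPerm p q : Equiv.Perm (Fin (N + M)))
            (Fin.castAdd M j)) := by
        intro l hl p q
        simp only [Equiv.Perm.mul_apply, blockPerm_castAdd, boxPerm_apply hl]
        exact (p.surjective.range_comp fun j => boxRow (M := M) l (Fin.castAdd M j)).symm
      rw [← StrictMono.range_inj (fun _ _ hj => boxRow_castAdd_lt hl hj)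
        (fun _ _ hj => boxRow_castAdd_lt hl' hj), hr hl p q, hr hl' p' q', h]
    have hll : l = l' := by
      funext j
      have := congrArg (fun f => (f j : ℕ)) hrow
      simp only [boxRow_castAdd] at this
      have := hb j
      have := hb' j
      omega
    subst hll
    obtain ⟨rfl, rfl⟩ := blockPerm_injective (mul_left_cancel h)
    rfl
  · rintro σ -
    let S : Finset (Fin (N + M)) := univ.image fun j => σ (Fin.castAdd M j)
    have hS : S.card = N := by
      rw [show S = univ.image (σ ∘ Fin.castAdd M) from rfl,
        card_image_of_injective _ (σ.injective.comp (Fin.castAdd_injective N M)), card_univ,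
        Fintype.card_fin]
    obtain ⟨l, hl, hla⟩ := exists_boxRow_eq (S.orderEmbOfFin hS).strictMono
    have hl' := (mem_boxPartitions.mp hl).2
    obtain ⟨p, q, hpq⟩ := exists_blockPerm_eq (τ := (boxPerm l)⁻¹ * σ) fun j => by
      have hmem : σ (Fin.castAdd M j) ∈ Set.range (S.orderEmbOfFin hS) := by
        rw [range_orderEmbOfFin]
        exact mem_coe.mpr (mem_image_of_mem _ (mem_univ j))
      obtain ⟨j', hj'⟩ := hmem
      refine ⟨j', ?_⟩
      rw [Equiv.Perm.mul_apply, Equiv.Perm.inv_eq_iff_eq, boxPerm_apply hl', hla, hj']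
    refine ⟨⟨l, p, q⟩, by simpa using hl, ?_⟩
    simp [hpq]

end Laplace

/-! ### Sign bookkeeping and the final assembly -/

/-- One sign comes from `z - c` and one from each of the `μ` factors containing `α`; the remaining
factors depend only on the products `γ z` and `γ z⁻¹`. -/
theorem h_neg {K : Type*} [Field K] {L : ℕ} (c : K) (α γ : Fin L → K) (μ : ℕ) (hμ : μ ≤ L)
    (z : K) : h (-c) (-α) (-γ) μ z = (-1) ^ (μ + 1) * h c α γ μ (-z) := by
  have h1 : ∏ i ∈ univ.filter (fun i : Fin L => (i : ℕ) < μ),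
      ((-α) i + (1 - (-α) i * (-γ) i) * z) =
      (-1) ^ μ * ∏ i ∈ univ.filter (fun i : Fin L => (i : ℕ) < μ),
        (α i + (1 - α i * γ i) * -z) := by
    have hc : #(univ.filter fun i : Fin L => (i : ℕ) < μ) = μ := by
      rw [Fin.card_filter_val_lt, min_eq_right hμ]
    have hp : (-1 : K) ^ μ = ∏ _i ∈ univ.filter (fun i : Fin L => (i : ℕ) < μ), (-1) := by
      rw [prod_const, hc]
    rw [hp, ← prod_mul_distrib]
    refine prod_congr rfl fun i _ => ?_
    simp only [Pi.neg_apply]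
    ring
  rw [h, h, h1, inv_neg]
  simp only [Pi.neg_apply, neg_mul, mul_neg]
  ring

theorem staircase_hat_lt {N M : ℕ} (l : Fin N → ℕ) (i : Fin M) :
    (hat M l + staircase M) i < N + M := by
  have := hat_le l i
  simp only [Pi.add_apply, staircase]
  omega

/-- The row signs from `h_neg` have exponents `hat M l i + (M - i)`. Their `hat` part cancels the
Laplace sign, leaving a sign independent of `l`. -/
theorem sum_H_mul_H {K : Type*} [Field K] {N M : ℕ} (c : K) (α γ : Fin (N + M) → K)
    (x : Fin N → K) (y : Fin M → K) :
    ∑ l ∈ boxPartitions N M, H c α γ (l + staircase N) x *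
        H (-c) (-α) (-γ) (hat M l + staircase M) y =
      (∏ k : Fin M, (-1) ^ (M - (k : ℕ))) *
        H c α γ (staircase (N + M)) (Fin.append x (-y)) := by
  rw [H, det_eq_sum_boxPartitions, mul_sum]
  refine sum_congr rfl fun l hl => ?_
  have hM := (mem_boxPartitions.mp hl).1
  have h1 : H c α γ (l + staircase N) x = (Matrix.of fun j k : Fin N => (Matrix.of
      fun a b => h c α γ (staircase (N + M) a) (Fin.append x (-y) b) -
        h c α γ (staircase (N + M) a) (Fin.append x (-y) b)⁻¹)
      (boxRow l (Fin.castAdd M j)) (Fin.castAdd M k)).det := by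
    rw [H]
    congr 1
    ext j k
    have : staircase (N + M) (boxRow l (Fin.castAdd M j)) = (l + staircase N) j := by
      have := hM j
      simp only [staircase, boxRow_castAdd, Pi.add_apply]
      omega
    simp only [Matrix.of_apply, Fin.append_left, this]
  have h2 : H (-c) (-α) (-γ) (hat M l + staircase M) y =
      (∏ i : Fin M, (-1) ^ (hat M l i + (M - (i : ℕ)))) * (Matrix.of fun i k : Fin M => (Matrix.of
      fun a b => h c α γ (staircase (N + M) a) (Fin.append x (-y) b) -
        h c α γ (staircase (N + M) a) (Fin.append x (-y) b)⁻¹)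
      (boxRow l (Fin.natAdd N i)) (Fin.natAdd N k)).det := by
    rw [H, ← Matrix.det_mul_column]
    congr 1
    ext i k
    have h3 : staircase (N + M) (boxRow l (Fin.natAdd N i)) = (hat M l + staircase M) i := by
      have := hat_le l i
      simp only [staircase, boxRow_natAdd, Pi.add_apply]
      omega
    have h4 : (hat M l + staircase M) i + 1 = hat M l i + (M - (i : ℕ)) := by
      simp only [staircase, Pi.add_apply]
      omega
    have h5 := (staircase_hat_lt l i).le
    simp only [Matrix.of_apply, Fin.append_right, h3, h_neg c α γ _ h5, h4, Pi.neg_apply, inv_neg]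
    ring
  rw [h1, h2]
  simp only [pow_add, prod_mul_distrib]
  ring

end DualCauchy

theorem mainTheorem4 {K : Type*} [Field K] (N M : ℕ)
    (x : Fin N → K) (y : Fin M → K) (α γ : Fin (N + M) → K)
    (t r : K) (hr : r ^ 2 = -t)
    (hx : ∀ j, x j ≠ 0) (hy : ∀ k, y k ≠ 0)
    (hdx : DualCauchy.denom x ≠ 0) (hdy : DualCauchy.denom y ≠ 0) :
    ∑ l ∈ DualCauchy.boxPartitions N M,
        DualCauchy.oPlus r α γ l x * DualCauchy.oMinus r (-α) (-γ) (DualCauchy.hat M l) y =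
      (∏ k : Fin M, y k ^ (-(N : ℤ))) *
        (∏ j : Fin (N + M), (1 + r * γ j)) *
        (∏ j : Fin N, ∏ k : Fin M, (1 + x j * y k) * (1 + (x j)⁻¹ * y k)) *
        (∏ j : Fin (N + M), ∏ k ∈ Finset.Ioi j, (1 + α j * (γ k - γ j))) *
        ∏ j : Fin (N + M), ∏ k ∈ Finset.Ioi j, (1 - γ j * γ k) := by
  have hden := DualCauchy.denom_append_neg hx hy
  have hz : ∀ k, Fin.append x (-y) k ≠ 0 := by
    intro k
    induction k using Fin.addCases <;> simp [hx, hy]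
  simp only [DualCauchy.oPlus, DualCauchy.oMinus, div_mul_div_comm]
  rw [← Finset.sum_div, DualCauchy.sum_H_mul_H, DualCauchy.H_staircase_eq r α γ hz, hden,
    DualCauchy.coeffDet_eq, div_eq_iff (mul_ne_zero hdx hdy)]
  -- The sign from `sum_H_mul_H` meets the same sign from `denom_append_neg`.
  have hs : (∏ k : Fin M, (-1 : K) ^ (M - (k : ℕ))) * ∏ k : Fin M, (-1) ^ (M - (k : ℕ)) = 1 := by
    rw [← Finset.prod_mul_distrib]
    exact Finset.prod_eq_one fun k _ => by rw [← mul_pow]; simp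
  generalize ∏ k : Fin M, (-1 : K) ^ (M - (k : ℕ)) = s at hs ⊢
  generalize (∏ j : Fin N, ∏ k : Fin M, (1 + x j * y k) * (1 + (x j)⁻¹ * y k)) = a
  generalize (∏ k : Fin M, y k ^ (-(N : ℤ))) = b
  generalize (∏ j : Fin (N + M), (1 + r * γ j)) = d
  generalize (∏ j : Fin (N + M), ∏ k ∈ Finset.Ioi j, (1 + α j * (γ k - γ j))) = e
  generalize (∏ j : Fin (N + M), ∏ k ∈ Finset.Ioi j, (1 - γ j * γ k)) = f
  linear_combination d * e * f * DualCauchy.denom x * DualCauchy.denom y * b * a * hs
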